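/- Let $Y$ be a real linear space and let $C\subset Y$ be a non-trivial pointed convex cone, i.e. $C$ is convex, $\lambda c\in C$ for all $c\in C$ and $\lambda\ge 0$, $C\cap(-C)=\{0\}$, $C\neq\{0\}$ and $C\ne Y$. Let $k\in\operatorname{core}C$, where $$\operatorname{core}C=\{x\in Y\mid \forall v\in Y\ \exists\delta>0\ \forall t\in[0,\delta]:\ x+tv\in C\},$$ put $[-k,k]_C:=(C-k)\cap(k-C)$, and let $p(y)=\inf\{\lambda>0\mid y\in\lambda[-k,k]_C\}$ be the Minkowski functional of $[-k,k]_C$. A base of $C$ is a nonempty convex set $B\subseteq C$ such that every $c\in C\setminus\{0\}$ has a unique representation $c=\lambda b$ with $\lambda>0$, $b\in B$. The set $C$ is algebraically closed if it contains every $x\in Y$ for which there is $a\in C\setminus\{x\}$ with $ta+(1-t)x\in C$ for all $t\in(0,1]$. A weakly compact set is a set that is compact and Hausdorff in the topology induced by the weak topology $\sigma(E,E')$ of the (semi)normed or topological vector space $E$ in question. Topological vector spaces are not assumed to be Hausdorff unless this is said. An Asplund space is a Banach space on which every continuous convex function on an open convex set $U$ is Fréchet differentiable at all points of a dense $G_\delta$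 subset of $U$. Then $[-k,k]_C$ is absorbing (so $p$ is finite-valued) and the following hold. (a) $p$ is a seminorm. (b) If $C$ is algebraically closed, then $p$ is a norm and $[-k,k]_C=\{y\in Y\mid p(y)\le 1\}$. (c) If $C$ has a base that is weakly compact in the seminormed space $(Y,p)$, then $p$ is a norm and $(Y,p)$ is reflexive; $(Y,p)$ is then also a Banach space and an Asplund space. Moreover, if $Y$ is a Hausdorff locally convex space and $C$ has a base that is weakly compact in $Y$, then $p$ is a norm and $(Y,p)$ is a Banach space; if in addition $Y$ is barrelled (for instance, a Banach space), then $(Y,p)$ is reflexive and an Asplund space. (d) If $Y$ is a finite-dimensional Hausdorff topological vector space, then $p$ is continuous. (e) If $Y$ is a topological vector space and $C$ is closed, then $p$ is a lower semicontinuous norm, $[-k,k]_C=\{y\in Y\mid p(y)\le1\}$ is its closed unit ball, and $C$ has nonempty interior in the normed space $(Y,p)$. (f) If, in addition to the assumptions of (e), $k\in\operatorname{int}C$, then $p$ is continuous. Corollary. If $Y$ is a topological vector space and $C\subset Y$ is a non-trivial closed pointed convex cone with nonempty core, then there is a norm on $Y$ such that $\operatorname{core}C$ is the interior of $C$ in the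 topology of this norm. -/

import Mathlib

open Set

/-- A non-trivial pointed convex cone in a real linear space: closed under multiplication by
nonnegative scalars, convex, containing no line, and different from `{0}` and the whole space. -/
structure IsNontrivialPointedConvexCone {Y : Type*} [AddCommGroup Y] [Module ℝ Y]
    (C : Set Y) : Prop where
  smul_mem : ∀ c ∈ C, ∀ t : ℝ, 0 ≤ t → t • c ∈ C
  convex : Convex ℝ C
  pointed : ∀ c ∈ C, -c ∈ C → c = 0
  ne_zero : C ≠ {0}
  ne_univ : C ≠ univ

/-- The core (algebraic interior) of a set. -/
def algCore {Y : Type*} [AddCommGroup Y] [Module ℝ Y] (A : Set Y) : Set Y :=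
  {x | ∀ v : Y, ∃ δ : ℝ, 0 < δ ∧ ∀ t : ℝ, 0 ≤ t → t ≤ δ → x + t • v ∈ A}

/-- The points of `A`, together with the points linearly accessible from `A`. -/
def algClosure {Y : Type*} [AddCommGroup Y] [Module ℝ Y] (A : Set Y) : Set Y :=
  A ∪ {x | ∃ a ∈ A, a ≠ x ∧ ∀ t : ℝ, 0 < t → t ≤ 1 → t • a + (1 - t) • x ∈ A}

/-- Algebraically closed sets. -/
def IsAlgClosedSet {Y : Type*} [AddCommGroup Y] [Module ℝ Y] (A : Set Y) : Prop :=
  algClosure A = A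

/-- The order relation `x ≤_C y` of a cone `C`. -/
def coneLE {Y : Type*} [AddCommGroup Y] (C : Set Y) (x y : Y) : Prop := y - x ∈ C

/-- The order interval `[a, b]_C`. -/
def orderInterval {Y : Type*} [AddCommGroup Y] (C : Set Y) (a b : Y) : Set Y :=
  {y | coneLE C a y ∧ coneLE C y b}

/-- `B` is a base of the cone `C`: a nonempty convex subset of `C` such that every nonzero element
of `C` is, in exactly one way, a positive multiple of an element of `B`. -/
structure IsConeBase {Y : Type*} [AddCommGroup Y] [Module ℝ Y] (B C : Set Y) : Prop where
  nonempty : B.Nonempty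
  subset : B ⊆ C
  convex : Convex ℝ B
  existsUnique : ∀ c ∈ C, c ≠ 0 → ∃! z : ℝ × Y, 0 < z.1 ∧ z.2 ∈ B ∧ c = z.1 • z.2

/-- The seminorm `q` is a norm. -/
def IsNorm {Y : Type*} [AddCommGroup Y] [Module ℝ Y] (q : Seminorm ℝ Y) : Prop :=
  ∀ y, q y = 0 → y = 0

/-- The space `(Y, q)`: a copy of `Y` that carries the seminorm `q` and its topology. -/
def SeminormedCopy {Y : Type*} [AddCommGroup Y] [Module ℝ Y] (_q : Seminorm ℝ Y) : Type _ := Y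

noncomputable instance SeminormedCopy.instSeminormedAddCommGroup {Y : Type*} [AddCommGroup Y]
    [Module ℝ Y] (q : Seminorm ℝ Y) : SeminormedAddCommGroup (SeminormedCopy q) :=
  (AddGroupSeminorm.toSeminormedAddCommGroup q.toAddGroupSeminorm : SeminormedAddCommGroup Y)

instance SeminormedCopy.instModule {Y : Type*} [AddCommGroup Y] [Module ℝ Y]
    (q : Seminorm ℝ Y) : Module ℝ (SeminormedCopy q) :=
  (inferInstance : Module ℝ Y)

instance SeminormedCopy.instNormedSpace {Y : Type*} [AddCommGroup Y] [Module ℝ Y]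
    (q : Seminorm ℝ Y) : NormedSpace ℝ (SeminormedCopy q) where
  norm_smul_le a b := (map_smul_eq_mul q a b).le

/-- The identity map from `Y` to `(Y, q)`. -/
def SeminormedCopy.equiv {Y : Type*} [AddCommGroup Y] [Module ℝ Y] (q : Seminorm ℝ Y) :
    Y ≃ₗ[ℝ] SeminormedCopy q :=
  LinearEquiv.refl ℝ Y

theorem SeminormedCopy.norm_equiv {Y : Type*} [AddCommGroup Y] [Module ℝ Y] (q : Seminorm ℝ Y)
    (y : Y) : ‖SeminormedCopy.equiv q y‖ = q y := rfl

/-- Weak compactness (compact and Hausdorff in the topology induced by the weak topology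
`σ(E, E')`). The Hausdorff part is automatic if continuous functionals separate points. -/
def IsWeaklyCompact {E : Type*} [AddCommGroup E] [Module ℝ E] [TopologicalSpace E]
    [IsTopologicalAddGroup E] [ContinuousSMul ℝ E] (B : Set E) : Prop :=
  IsCompact (toWeakSpace ℝ E '' B) ∧ T2Space (toWeakSpace ℝ E '' B)

/-- Reflexivity: the canonical map into the topological bidual is onto. -/
def IsReflexiveSpace (E : Type*) [SeminormedAddCommGroup E] [NormedSpace ℝ E] : Prop :=
  Function.Surjective (NormedSpace.inclusionInDoubleDual ℝ E)

/-- The differentiability property of Asplund spaces: every continuous convex function on an open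
convex set `U` is Fréchet differentiable at all points of a dense Gδ subset of `U`. -/
def IsAsplundSpace (E : Type*) [SeminormedAddCommGroup E] [NormedSpace ℝ E] : Prop :=
  ∀ (U : Set E) (f : E → ℝ), IsOpen U → ConvexOn ℝ U f → ContinuousOn f U →
    ∃ G : Set E, G ⊆ U ∧ IsGδ G ∧ U ⊆ closure G ∧ ∀ x ∈ G, DifferentiableAt ℝ f x

/-! Everything rests on one reading of the gauge `p`: if `p y < r`, then `r • k + y` and `r • k - y`
lie in `C`, and for `r > 0` these memberships give `p y ≤ r`. Algebraic closedness allows the limit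
`r ↓ p y`, which gives (b); closedness of `C` reduces (e) to it, and neighbourhoods of `k` inside
`C` give (f). For (c), a base defines a height `l` on `C`, additive and equal to `1` on the base.
The vectors `r • k + y` and `r • k - y` sum to `(2 * r) • k`, so each has height at most `2 * r * l
k`. Hence the order interval lies in a translate of `[0, 2 * r * l k] • B`, which is weakly compact
when `B` is (`mem_smul_base_of_mem`). If `B` is weakly compact for `(Y, p)`, so is the closed unit
ball there, and Helly's argument gives reflexivity (`isReflexiveSpace_of_isCompact`). For another
topology on `Y`, weak compactness of the intervals gives the norm property and completeness;
barrelledness makes `p` continuous and carries compactness of `B` over to `(Y, p)`. Reflexive spaces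
are Asplund by separable reduction: closed separable subspaces are reflexive with separable dual,
where Baire's theorem yields open sets on which a convex function is almost affine. -/

/-! ### Convex functions on reflexive spaces -/

open TopologicalSpace Metric Topology in
theorem ConvexOn.exists_subgradient {E : Type*} [NormedAddCommGroup E] [NormedSpace ℝ E]
    {U : Set E} {f : E → ℝ} (hU : IsOpen U) (hf : ConvexOn ℝ U f) (hc : ContinuousOn f U)
    {x : E} (hx : x ∈ U) : ∃ g : StrongDual ℝ E, ∀ y ∈ U, f x + g (y - x) ≤ f y := by
  have hopen : IsOpen {p : E × ℝ | p.1 ∈ U ∧ f p.1 < p.2} := by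
    have h1 : ContinuousOn (fun p : E × ℝ => p.2 - f p.1) (Prod.fst ⁻¹' U) :=
      continuousOn_snd.sub (hc.comp continuousOn_fst fun p hp => hp)
    have h2 := h1.isOpen_inter_preimage (hU.preimage continuous_fst) (isOpen_Ioi (a := (0 : ℝ)))
    convert h2 using 1
    ext p
    simp
  obtain ⟨φ, hφ⟩ := geometric_hahn_banach_open_point hf.convex_strict_epigraph hopen
    (x := (x, f x)) (fun h => lt_irrefl _ h.2)
  have hsplit : ∀ (y : E) (r : ℝ), φ (y, r) = φ (y, 0) + r * φ (0, 1) := by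
    intro y r
    rw [← smul_eq_mul, ← map_smul, ← map_add]
    simp
  have hneg : φ (0, 1) < 0 := by
    have := hφ (x, f x + 1) ⟨hx, by simp⟩
    rw [hsplit, hsplit x (f x)] at this
    linarith
  refine ⟨(-φ (0, 1))⁻¹ • φ.comp (ContinuousLinearMap.inl ℝ E ℝ), fun y hy => ?_⟩
  have hle : φ (y, 0) + f y * φ (0, 1) ≤ φ (x, 0) + f x * φ (0, 1) := by
    refine le_of_forall_pos_lt_add fun ε hε => ?_
    have := hφ (y, f y + ε / (-φ (0, 1))) ⟨hy, by simpa using div_pos hε (neg_pos.2 hneg)⟩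
    rw [hsplit, hsplit x (f x), add_mul, div_mul_eq_mul_div, div_neg,
      mul_div_cancel_right₀ _ hneg.ne] at this
    linarith
  have hsub : φ (y - x, 0) = φ (y, 0) - φ (x, 0) := by rw [← map_sub]; simp
  have hmain : (-φ (0, 1))⁻¹ * φ (y - x, 0) ≤ f y - f x := by
    rw [inv_mul_le_iff₀ (neg_pos.2 hneg), hsub]
    nlinarith
  simpa using (by linarith : f x + (-φ (0, 1))⁻¹ * φ (y - x, 0) ≤ f y)

-- Baire's theorem applies to the closed sets `A n` of points where the `n`th member of a dense
-- sequence of functionals is an `η`-approximate subgradient. They cover `U` because a true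
-- subgradient is within `η` of some member.
open TopologicalSpace Metric Topology in
theorem ConvexOn.exists_isOpen_sub_le_of_separable_dual {E : Type*} [NormedAddCommGroup E]
    [NormedSpace ℝ E] [CompleteSpace E] [SeparableSpace (StrongDual ℝ E)]
    {U : Set E} {f : E → ℝ} (hU : IsOpen U) (hne : U.Nonempty) (hf : ConvexOn ℝ U f)
    (hc : ContinuousOn f U) {η : ℝ} (hη : 0 < η) :
    ∃ V ⊆ U, IsOpen V ∧ V.Nonempty ∧ ∃ g : StrongDual ℝ E,
      ∀ x ∈ V, ∀ y ∈ V, f x - f y - g (x - y) ≤ η * ‖x - y‖ := by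
  have : BaireSpace U := hU.baireSpace
  have : Nonempty U := hne.to_subtype
  let g : ℕ → StrongDual ℝ E := denseSeq _
  let A : ℕ → Set U := fun n => {x | ∀ y : U, f x - f y - g n (x - y) ≤ η * ‖(x : E) - y‖}
  have hcU : Continuous fun x : U => f x := hc.domRestrict
  have hA : ∀ n, IsClosed (A n) := fun n => by
    simp only [A, ofPred_forall]
    exact isClosed_iInter fun y => isClosed_le
      ((hcU.sub continuous_const).sub ((g n).continuous.comp (continuous_subtype_val.sub continuous_const)))
      (by fun_prop)
  have hcover : ⋃ n, A n = univ := by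
    refine eq_univ_of_forall fun x => ?_
    obtain ⟨φ, hφ⟩ := hf.exists_subgradient hU hc x.2
    obtain ⟨n, hn⟩ := (denseRange_denseSeq (StrongDual ℝ E)).exists_dist_lt φ hη
    refine mem_iUnion.2 ⟨n, fun y => ?_⟩
    have h1 := hφ y y.2
    have h2 : (φ - g n) (x - y) ≤ η * ‖(x : E) - y‖ :=
      (le_abs_self _).trans (((φ - g n).le_opNorm _).trans (by
        gcongr
        rw [← dist_eq_norm]
        exact hn.le))
    simp only [map_sub, sub_apply] at h1 h2 ⊢
    linarith
  obtain ⟨n, hn⟩ := nonempty_interior_of_iUnion_of_closed hA hcover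
  refine ⟨Subtype.val '' interior (A n), by simp, hU.isOpenMap_subtype_val _ isOpen_interior,
    hn.image _, g n, ?_⟩
  rintro _ ⟨x, hx, rfl⟩ _ ⟨y, -, rfl⟩
  exact interior_subset hx y

theorem Submodule.mem_of_forall_dual_eq_zero {E : Type*} [NormedAddCommGroup E]
    [NormedSpace ℝ E] (M : Submodule ℝ E) (hM : IsClosed (M : Set E)) {x : E}
    (h : ∀ φ : StrongDual ℝ E, (∀ y ∈ M, φ y = 0) → φ x = 0) : x ∈ M := by
  by_contra hx
  obtain ⟨φ, u, h1, h2⟩ := geometric_hahn_banach_closed_point M.convex hM hx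
  have h0 : 0 < u := by simpa using h1 0 M.zero_mem
  have hφ : φ x = 0 := h φ fun y hy => by
    by_contra hy0
    have := h1 ((u / φ y) • y) (M.smul_mem _ hy)
    rw [map_smul, smul_eq_mul, div_mul_cancel₀ _ hy0] at this
    exact lt_irrefl _ this
  linarith

theorem IsReflexiveSpace.submodule {E : Type*} [NormedAddCommGroup E] [NormedSpace ℝ E]
    (hE : IsReflexiveSpace E) (M : Submodule ℝ E) (hM : IsClosed (M : Set E)) :
    IsReflexiveSpace M := by
  intro ψ
  let R : StrongDual ℝ E →L[ℝ] StrongDual ℝ M := ContinuousLinearMap.precomp ℝ M.subtypeL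
  obtain ⟨x, hx⟩ := hE (ψ.comp R)
  have hx' : ∀ φ : StrongDual ℝ E, φ x = ψ (φ.comp M.subtypeL) := fun φ =>
    DFunLike.congr_fun hx φ
  have hxM : x ∈ M := M.mem_of_forall_dual_eq_zero hM fun φ hφ => by
    have : φ.comp M.subtypeL = 0 := by ext y; exact hφ y y.2
    rw [hx', this, map_zero]
  refine ⟨⟨x, hxM⟩, ?_⟩
  ext θ
  obtain ⟨φ, hφ, -⟩ := exists_extension_norm_eq M θ
  have hφθ : φ.comp M.subtypeL = θ := by ext y; exact hφ y
  rw [NormedSpace.dual_def, ← hφθ, ← hx' φ]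
  rfl

-- Norming functionals of a dense sequence span a dense subspace: by reflexivity an annihilator of
-- them is evaluation at some `x`, and a nonzero `x` would be close to a vector on which its norming
-- functional is too large.
open TopologicalSpace in
theorem IsReflexiveSpace.separableSpace_dual {E : Type*} [NormedAddCommGroup E] [NormedSpace ℝ E]
    [SeparableSpace E] (hE : IsReflexiveSpace E) : SeparableSpace (StrongDual ℝ E) := by
  choose φ hφ1 hφ2 using fun n => exists_dual_vector'' ℝ (denseSeq E n)
  let M := (Submodule.span ℝ (range φ)).topologicalClosure
  have hM : M = ⊤ := by
    refine eq_top_iff.2 fun θ _ => M.mem_of_forall_dual_eq_zero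
      (Submodule.isClosed_topologicalClosure _) fun ψ hψ => ?_
    obtain ⟨x, rfl⟩ := hE ψ
    have hx : ∀ n, φ n x = 0 := fun n =>
      hψ _ (Submodule.le_topologicalClosure _ (Submodule.subset_span (mem_range_self n)))
    suffices x = 0 by simp [this]
    by_contra hx0
    obtain ⟨n, hn⟩ := (denseRange_denseSeq E).exists_dist_lt x (half_pos (norm_pos_iff.2 hx0))
    have h1 : ‖denseSeq E n‖ ≤ ‖denseSeq E n - x‖ := by
      have := hφ2 n
      calc ‖denseSeq E n‖ = φ n (denseSeq E n - x) := by rw [map_sub, hx, sub_zero, this]; rfl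
        _ ≤ ‖φ n (denseSeq E n - x)‖ := Real.le_norm_self _
        _ ≤ 1 * ‖denseSeq E n - x‖ := (φ n).le_of_opNorm_le (hφ1 n) _
        _ = _ := one_mul _
    have h2 := norm_le_norm_add_norm_sub (denseSeq E n) x
    rw [dist_eq_norm, norm_sub_rev] at hn
    linarith
  have hsep : IsSeparable (M : Set (StrongDual ℝ E)) :=
    ((countable_range φ).isSeparable.span (R := ℝ)).closure
  rw [hM] at hsep
  exact isSeparable_univ_iff.1 hsep

-- Subtracting a supporting affine function leaves a nonnegative convex function, bounded by `ε * δ`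
-- because its values at reflected points add up to a second difference. Bounded convex functions
-- are Lipschitz on the half ball. Failure of flatness is thus witnessed by a single vector `u`,
-- which a separable subspace can capture.
open Metric in
theorem ConvexOn.exists_sub_le_of_second_difference_le {E : Type*} [NormedAddCommGroup E]
    [NormedSpace ℝ E] {f : E → ℝ} {x : E} {δ ε : ℝ} (hδ : 0 < δ) (hε : 0 < ε)
    (hf : ConvexOn ℝ (ball x δ) f) (hc : ContinuousOn f (ball x δ))
    (h : ∀ u, ‖u‖ < δ → f (x + u) + f (x - u) - 2 * f x ≤ ε * δ) :
    ∃ g : StrongDual ℝ E, ∀ y ∈ ball x (δ / 2), ∀ z ∈ ball x (δ / 2),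
      f y - f z - g (y - z) ≤ 4 * ε * ‖y - z‖ := by
  obtain ⟨g, hg⟩ := hf.exists_subgradient isOpen_ball hc (mem_ball_self hδ)
  have hconv : ConvexOn ℝ (ball x δ) fun y => f y + ((-g) y + (g x - f x)) :=
    hf.add (((-g).toLinearMap.convexOn (convex_ball x δ)).add_const _)
  have hbd : ∀ y, dist y x < δ → |f y + ((-g) y + (g x - f x))| ≤ ε * δ := by
    intro y hy
    have h1 := hg y hy
    have h2 := h (y - x) (by rwa [← dist_eq_norm])
    have h3 := hg (x - (y - x)) (by
      rw [mem_ball, dist_eq_norm]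
      simpa [dist_eq_norm, norm_sub_rev] using hy)
    simp only [add_sub_cancel, map_sub, neg_apply] at h1 h2 h3 ⊢
    rw [abs_le]
    constructor <;> nlinarith [mul_pos hε hδ]
  have hlip := hconv.lipschitzOnWith_of_abs_le (half_pos hδ) hbd
  rw [sub_half] at hlip
  refine ⟨g, fun y hy z hz => ?_⟩
  have h4 := hlip.dist_le_mul y hy z hz
  have h5 : 2 * (ε * δ) / (δ / 2) = 4 * ε := by field_simp; norm_num
  rw [h5, Real.coe_toNNReal _ (by positivity), dist_eq_norm, dist_eq_norm] at h4
  have h6 := (Real.le_norm_self _).trans h4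
  simp only [neg_apply, map_sub] at h6 ⊢
  linarith

-- Witnesses are adjoined only for a countable dense subset at each stage, since `u` need not be
-- continuous; the union of these subsets is dense in the closed limit subspace.
open TopologicalSpace in
theorem exists_isSeparable_submodule_closed_under {E : Type*} [NormedAddCommGroup E]
    [NormedSpace ℝ E] {ι : Type*} [Countable ι] (u : E → ι → E) (x₀ : E) :
    ∃ F : Submodule ℝ E, IsClosed (F : Set E) ∧ IsSeparable (F : Set E) ∧ x₀ ∈ F ∧
      ∃ D : Set E, D ⊆ F ∧ (F : Set E) ⊆ closure D ∧ ∀ x ∈ D, ∀ i, u x i ∈ F := by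
  have hstep : ∀ M : {M : Submodule ℝ E // IsSeparable (M : Set E)},
      ∃ (M' : {M : Submodule ℝ E // IsSeparable (M : Set E)}) (D : Set E), M.1 ≤ M'.1 ∧
        D ⊆ M.1 ∧ (M.1 : Set E) ⊆ closure D ∧ ∀ x ∈ D, ∀ i, u x i ∈ M'.1 := by
    rintro ⟨M, hM⟩
    obtain ⟨D, hDM, hD, hMD⟩ := hM.exists_countable_dense_subset
    have hcount : (image2 u D univ).Countable := hD.image2 countable_univ _
    refine ⟨⟨M ⊔ Submodule.span ℝ (image2 u D univ), ?_⟩, D, le_sup_left, hDM, hMD,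
      fun x hx i => ?_⟩
    · rw [← Submodule.span_eq M, ← Submodule.span_union]
      exact (hM.union hcount.isSeparable).span
    · exact Submodule.mem_sup_right (Submodule.subset_span (mem_image2_of_mem hx (mem_univ i)))
  choose next D hle hDsub hdense hmem using hstep
  let M : ℕ → {M : Submodule ℝ E // IsSeparable (M : Set E)} := fun n =>
    next^[n] ⟨Submodule.span ℝ {x₀}, ((countable_singleton x₀).isSeparable).span⟩
  have hsucc : ∀ n, M (n + 1) = next (M n) := fun n => Function.iterate_succ_apply' _ _ _
  have hmono : Monotone fun n => (M n).1 := monotone_nat_of_le_succ fun n => by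
    rw [hsucc]
    exact hle _
  have hcoe : ((⨆ n, (M n).1 : Submodule ℝ E) : Set E) = ⋃ n, ((M n).1 : Set E) :=
    Submodule.coe_iSup_of_directed _ hmono.directed_le
  have hsub : ∀ n, ((M n).1 : Set E) ⊆ (⨆ n, (M n).1 : Submodule ℝ E).topologicalClosure :=
    fun n => (le_iSup (fun n => (M n).1) n).trans (Submodule.le_topologicalClosure _)
  refine ⟨(⨆ n, (M n).1).topologicalClosure, Submodule.isClosed_topologicalClosure _, ?_,
    hsub 0 (Submodule.mem_span_singleton_self x₀), ⋃ n, D (M n),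
    iUnion_subset fun n => (hDsub _).trans (hsub n), ?_, ?_⟩
  · rw [Submodule.topologicalClosure_coe, isSeparable_closure, hcoe]
    exact IsSeparable.iUnion fun n => (M n).2
  · rw [Submodule.topologicalClosure_coe, hcoe]
    exact closure_minimal (iUnion_subset fun n =>
      (hdense _).trans (closure_mono (subset_iUnion (fun n => D (M n)) n))) isClosed_closure
  · intro x hx i
    obtain ⟨n, hn⟩ := mem_iUnion.1 hx
    refine hsub (n + 1) ?_
    rw [hsucc]
    exact hmem _ x hn i

theorem IsReflexiveSpace.completeSpace {E : Type*} [NormedAddCommGroup E] [NormedSpace ℝ E]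
    (hE : IsReflexiveSpace E) : CompleteSpace E :=
  (LinearIsometryEquiv.ofSurjective (NormedSpace.inclusionInDoubleDualLi ℝ (E := E))
    hE).toIsometryEquiv.completeSpace

open TopologicalSpace Metric in
theorem IsReflexiveSpace.exists_isOpen_sub_le {E : Type*} [NormedAddCommGroup E]
    [NormedSpace ℝ E] (hE : IsReflexiveSpace E) {U : Set E} {f : E → ℝ} (hU : IsOpen U)
    (hne : U.Nonempty) (hf : ConvexOn ℝ U f) (hc : ContinuousOn f U) {ε : ℝ} (hε : 0 < ε) :
    ∃ V ⊆ U, IsOpen V ∧ V.Nonempty ∧ ∃ g : StrongDual ℝ E,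
      ∀ x ∈ V, ∀ y ∈ V, f x - f y - g (x - y) ≤ ε * ‖x - y‖ := by
  by_contra hcon
  have := hE.completeSpace
  have hbad : ∀ (x : E) (q : ℚ), ∃ u : E, 0 < (q : ℝ) → ball x q ⊆ U →
      ‖u‖ < q ∧ ε / 4 * q < f (x + u) + f (x - u) - 2 * f x := by
    intro x q
    by_cases hq : 0 < (q : ℝ) ∧ ball x q ⊆ U
    · obtain ⟨hq0, hqU⟩ := hq
      by_contra! hno
      -- With `ε / 4` the Lipschitz constant on the half ball is exactly `ε`, so that ball
      -- contradicts `hcon`.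
      obtain ⟨g, hg⟩ := ConvexOn.exists_sub_le_of_second_difference_le hq0
        (by positivity : 0 < ε / 4) (hf.subset hqU (convex_ball _ _)) (hc.mono hqU)
        fun u hu => (hno u).2.2 hu
      exact hcon ⟨ball x (q / 2), (ball_subset_ball (by linarith)).trans hqU, isOpen_ball,
        ⟨x, mem_ball_self (half_pos hq0)⟩, g, fun y hy z hz => by
          simpa [mul_div_cancel₀] using hg y hy z hz⟩
    · exact ⟨0, fun h1 h2 => absurd ⟨h1, h2⟩ hq⟩
  choose u hu using hbad
  obtain ⟨x₀, hx₀⟩ := hne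
  obtain ⟨F, hFc, hFs, hx₀F, D, hDF, hFD, hD⟩ := exists_isSeparable_submodule_closed_under u x₀
  have : CompleteSpace F := hFc.completeSpace_coe
  have : SeparableSpace F := hFs.separableSpace
  have : SeparableSpace (StrongDual ℝ F) := (hE.submodule F hFc).separableSpace_dual
  obtain ⟨V, hVU, hVo, ⟨v, hv⟩, g, hg⟩ :=
    ConvexOn.exists_isOpen_sub_le_of_separable_dual (U := ((↑) : F → E) ⁻¹' U)
      (f := fun x : F => f x) (hU.preimage continuous_subtype_val) ⟨⟨x₀, hx₀F⟩, hx₀⟩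
      (hf.comp_linearMap F.subtype) (hc.comp continuous_subtype_val.continuousOn fun x hx => hx)
      (by positivity : 0 < ε / 8)
  obtain ⟨O, hO, rfl⟩ := isOpen_induced_iff.1 hVo
  -- The point must be taken in `D`, where the witnesses are known to lie in `F`.
  obtain ⟨d, ⟨hdO, hdU⟩, hdD⟩ := mem_closure_iff.1 (hFD v.2) (O ∩ U) (hO.inter hU) ⟨hv, hVU hv⟩
  obtain ⟨δ, hδ, hball⟩ := Metric.isOpen_iff.1 (hO.inter hU) d ⟨hdO, hdU⟩
  obtain ⟨q, hq0, hqδ⟩ := exists_rat_btwn hδ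
  have hqb : ball d q ⊆ O ∩ U := (ball_subset_ball hqδ.le).trans hball
  obtain ⟨hu1, hu2⟩ := hu d q hq0 (hqb.trans inter_subset_right)
  let d' : F := ⟨d, hDF hdD⟩
  let w : F := ⟨u d q, hD d hdD q⟩
  -- Adding the two estimates cancels `g` and bounds the second difference by `2 * (ε / 8) * ‖w‖`,
  -- less than the `ε / 4 * q` of `hu2`.
  have hplus := hg (d' + w) (hqb (by simpa [d', w] using hu1)).1 d' hdO
  have hminus := hg (d' - w) (hqb (by simpa [d', w, dist_eq_norm] using hu1)).1 d' hdO
  have hw : ‖w‖ < q := hu1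
  simp only [add_sub_cancel_left, sub_sub_cancel_left, map_neg, norm_neg, Submodule.coe_add,
    Submodule.coe_sub, d', w] at hplus hminus hw
  nlinarith

theorem IsReflexiveSpace.isAsplundSpace {E : Type*} [NormedAddCommGroup E] [NormedSpace ℝ E]
    (hE : IsReflexiveSpace E) : IsAsplundSpace E := by
  intro U f hU hf hc
  have := hE.completeSpace
  let A : ℕ → Set (Set E) := fun n => {V | IsOpen V ∧ V ⊆ U ∧ ∃ g : StrongDual ℝ E,
    ∀ x ∈ V, ∀ y ∈ V, f x - f y - g (x - y) ≤ 1 / ((n : ℝ) + 1) * ‖x - y‖}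
  have hAo : ∀ n, IsOpen (⋃₀ A n) := fun n => isOpen_sUnion fun V hV => hV.1
  have hAU : ∀ n, ⋃₀ A n ⊆ U := fun n => sUnion_subset fun V hV => hV.2.1
  refine ⟨⋂ n, ⋃₀ A n, iInter_subset_of_subset 0 (hAU 0), .iInter fun n => (hAo n).isGδ, ?_, ?_⟩
  -- Adjoining the exterior of `U` makes these sets dense in all of `E`, where Baire's theorem is
  -- available.
  · have hdense : Dense (⋂ n, (⋃₀ A n ∪ (closure U)ᶜ)) := by
      refine dense_iInter_of_isOpen_nat (fun n => (hAo n).union isClosed_closure.isOpen_compl)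
        fun n => dense_iff_inter_open.2 fun O hO hOne => ?_
      by_cases hOU : (O ∩ U).Nonempty
      · obtain ⟨x, hxO, hxU⟩ := hOU
        obtain ⟨δ, hδ, hball⟩ := Metric.isOpen_iff.1 (hO.inter hU) x ⟨hxO, hxU⟩
        have hbU := hball.trans inter_subset_right
        obtain ⟨V, hV, hVo, ⟨v, hv⟩, g, hg⟩ := hE.exists_isOpen_sub_le
          (U := Metric.ball x δ) Metric.isOpen_ball ⟨x, Metric.mem_ball_self hδ⟩
          (hf.subset hbU (convex_ball _ _)) (hc.mono hbU) (ε := 1 / ((n : ℝ) + 1)) (by positivity)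
        exact ⟨v, (hball (hV hv)).1, Or.inl ⟨V, ⟨hVo, hV.trans hbU, g, hg⟩, hv⟩⟩
      · obtain ⟨x, hx⟩ := hOne
        refine ⟨x, hx, Or.inr fun hxU => hOU ?_⟩
        exact mem_closure_iff.1 hxU O hO hx
    intro x hx
    refine mem_closure_iff.2 fun O hO hxO => ?_
    obtain ⟨y, ⟨hyO, hyU⟩, hy⟩ := hdense.inter_open_nonempty _ (hO.inter hU) ⟨x, hxO, hx⟩
    refine ⟨y, hyO, mem_iInter.2 fun n => (mem_iInter.1 hy n).resolve_right ?_⟩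
    exact not_not.2 (subset_closure hyU)
  · intro x hx
    have hxU : x ∈ U := hAU 0 (mem_iInter.1 hx 0)
    obtain ⟨φ, hφ⟩ := hf.exists_subgradient hU hc hxU
    refine HasFDerivAt.differentiableAt (f' := φ) ?_
    rw [hasFDerivAt_iff_isLittleO, Asymptotics.isLittleO_iff]
    intro c hc0
    obtain ⟨n, hn⟩ := exists_nat_one_div_lt (half_pos hc0)
    obtain ⟨V, ⟨hVo, hVU, g, hg⟩, hxV⟩ := mem_iInter.1 hx n
    obtain ⟨δ, hδ, hball⟩ := Metric.isOpen_iff.1 hVo x hxV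
    filter_upwards [Metric.ball_mem_nhds x hδ] with y hy
    -- The functional `g` varies with `n` while `φ` does not; using the reflected point as well
    -- eliminates `g`.
    have hy' : x - (y - x) ∈ V := hball (by
      rw [Metric.mem_ball, dist_eq_norm]
      simpa [dist_eq_norm, norm_sub_rev] using hy)
    have h1 := hφ y (hVU (hball hy))
    have h2 := hφ _ (hVU hy')
    have h3 := hg y (hball hy) x hxV
    have h4 := hg _ hy' x hxV
    rw [sub_sub_cancel_left, map_neg] at h2 h4
    rw [norm_neg] at h4
    rw [Real.norm_eq_abs, abs_of_nonneg (by linarith)]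
    nlinarith [norm_nonneg (y - x)]

/-! ### Weak compactness and reflexivity -/

theorem continuous_weakSpace_apply {E : Type*} [AddCommGroup E] [Module ℝ E] [TopologicalSpace E]
    [IsTopologicalAddGroup E] [ContinuousSMul ℝ E] (φ : StrongDual ℝ E) :
    Continuous fun x : WeakSpace ℝ E => φ ((toWeakSpace ℝ E).symm x) :=
  WeakBilin.eval_continuous (topDualPairing ℝ E).flip φ

/-- Helly: finitely many equations `f x = φ f` with `‖φ‖ ≤ 1` are solvable in a weakly compact
closed unit ball. -/
theorem exists_norm_le_one_forall_apply_eq {E : Type*} [SeminormedAddCommGroup E] [NormedSpace ℝ E]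
    (hball : IsCompact (toWeakSpace ℝ E '' Metric.closedBall (0 : E) 1))
    (φ : StrongDual ℝ (StrongDual ℝ E)) (hφ : ‖φ‖ ≤ 1) (s : Finset (StrongDual ℝ E)) :
    ∃ x : E, ‖x‖ ≤ 1 ∧ ∀ f ∈ s, f x = φ f := by
  classical
  let T : E →ₗ[ℝ] (s → ℝ) := LinearMap.pi fun f => (f : StrongDual ℝ E).toLinearMap
  have hT : IsCompact (T '' Metric.closedBall (0 : E) 1) := by
    have := hball.image (f := fun x : WeakSpace ℝ E => T ((toWeakSpace ℝ E).symm x))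
      (continuous_pi fun f => continuous_weakSpace_apply (f : StrongDual ℝ E))
    simpa [image_image] using this
  by_cases hmem : (fun f : s => φ f) ∈ T '' Metric.closedBall (0 : E) 1
  · obtain ⟨x, hx, hxT⟩ := hmem
    exact ⟨x, by simpa using hx, fun f hf => congrFun hxT ⟨f, hf⟩⟩
  · exfalso
    obtain ⟨L, u, h1, h2⟩ := geometric_hahn_banach_closed_point
      ((convex_closedBall (0 : E) 1).linear_image T) hT.isClosed hmem
    have hL : ∀ v : s → ℝ, L v = ∑ f, v f * L (Pi.single f 1) := fun v => by
      conv_lhs => rw [pi_eq_sum_univ' v]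
      simp [map_sum]
    -- The separating functional pulls back to a combination `g` of members of `s` with `‖g‖ ≤ u < φ
    -- g`, impossible for `‖φ‖ ≤ 1`.
    let g : StrongDual ℝ E := ∑ f : s, L (Pi.single f 1) • (f : StrongDual ℝ E)
    have hg : ∀ x, g x = L (T x) := fun x => by
      rw [hL]
      simp [g, T, mul_comm]
    have hgφ : φ g = L fun f : s => φ f := by
      rw [hL]
      simp [g, map_sum, mul_comm]
    have hu : 0 < u := by simpa using h1 (T 0) ⟨0, by simp, rfl⟩
    have hnorm : ‖g‖ ≤ u := g.opNorm_le_of_unit_norm hu.le fun x hx => by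
      rw [Real.norm_eq_abs, abs_le]
      have ha := h1 (T x) ⟨x, by simp [hx], rfl⟩
      have hb := h1 (T (-x)) ⟨-x, by simp [hx], rfl⟩
      rw [← hg] at ha hb
      rw [map_neg] at hb
      constructor <;> linarith
    have := (Real.le_norm_self _).trans ((φ.le_opNorm g).trans
      (mul_le_mul hφ hnorm (norm_nonneg _) zero_le_one))
    linarith

/-- The closed unit ball is convex and closed, hence weakly closed and so weakly compact. Helly's
lemma then supplies the finite intersection property for the weakly closed sets where `f` takes the
value `φ f`. -/
theorem isReflexiveSpace_of_isCompact {E : Type*} [SeminormedAddCommGroup E] [NormedSpace ℝ E]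
    {K : Set E} (hK : IsCompact (toWeakSpace ℝ E '' K)) (hb : Metric.closedBall (0 : E) 1 ⊆ K) :
    IsReflexiveSpace E := by
  have hclosed : IsClosed (toWeakSpace ℝ E '' Metric.closedBall (0 : E) 1) := by
    have := (convex_closedBall (0 : E) 1).toWeakSpace_closure ℝ
    rw [Metric.isClosed_closedBall.closure_eq] at this
    rw [this]
    exact isClosed_closure
  have hball := hK.of_isClosed_subset hclosed (image_mono hb)
  suffices key : ∀ φ : StrongDual ℝ (StrongDual ℝ E), ‖φ‖ ≤ 1 →
      ∃ x : E, NormedSpace.inclusionInDoubleDual ℝ E x = φ by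
    intro φ
    obtain ⟨x, hx⟩ := key ((‖φ‖ + 1)⁻¹ • φ) (by
      refine (ContinuousLinearMap.opNorm_smul_le _ φ).trans ?_
      rw [norm_inv, Real.norm_of_nonneg (by positivity), inv_mul_le_iff₀ (by positivity)]
      linarith)
    exact ⟨(‖φ‖ + 1) • x, by rw [map_smul, hx, smul_inv_smul₀ (by positivity)]⟩
  intro φ hφ
  obtain ⟨w, ⟨x, -, rfl⟩, hx⟩ := hball.inter_iInter_nonempty
    (fun f : StrongDual ℝ E => {w : WeakSpace ℝ E | f ((toWeakSpace ℝ E).symm w) = φ f})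
    (fun f => isClosed_eq (continuous_weakSpace_apply f) continuous_const) fun s => by
      obtain ⟨x, hx, hxs⟩ := exists_norm_le_one_forall_apply_eq hball φ hφ s
      exact ⟨toWeakSpace ℝ E x, mem_image_of_mem _ (by simpa using hx),
        mem_iInter₂.2 fun f hf => by simpa using hxs f hf⟩
  refine ⟨x, ?_⟩
  ext f
  simpa using mem_iInter.1 hx f

theorem isCompact_toWeakSpace_image_smul_sub {E : Type*} [AddCommGroup E] [Module ℝ E]
    [TopologicalSpace E] [IsTopologicalAddGroup E] [ContinuousSMul ℝ E] {B : Set E}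
    (hB : IsCompact (toWeakSpace ℝ E '' B)) (M : ℝ) (a : E) :
    IsCompact (toWeakSpace ℝ E '' ((fun z : ℝ × E => z.1 • z.2 - a) '' Icc 0 M ×ˢ B)) := by
  have h := (isCompact_Icc (a := 0) (b := M)).prod hB
  have h2 := h.image (f := fun z : ℝ × WeakSpace ℝ E => z.1 • z.2 - toWeakSpace ℝ E a)
    (by fun_prop)
  convert h2 using 1
  ext w
  constructor
  · rintro ⟨_, ⟨⟨s, b⟩, ⟨hs, hb⟩, rfl⟩, rfl⟩
    exact ⟨(s, toWeakSpace ℝ E b), ⟨hs, mem_image_of_mem _ hb⟩, by simp⟩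
  · rintro ⟨⟨s, _⟩, ⟨hs, b, hb, rfl⟩, rfl⟩
    exact ⟨s • b - a, ⟨(s, b), ⟨hs, hb⟩, rfl⟩, by simp⟩

/-! ### The order interval, its gauge and the height of a base -/

theorem mem_orderInterval_neg {Y : Type*} [AddCommGroup Y] {C : Set Y} {k y : Y} :
    y ∈ orderInterval C (-k) k ↔ k + y ∈ C ∧ k - y ∈ C := by
  simp [orderInterval, coneLE, add_comm]

section Cone

variable {Y : Type*} [AddCommGroup Y] [Module ℝ Y] {B C : Set Y} {k : Y}

theorem IsNontrivialPointedConvexCone.add_mem (hC : IsNontrivialPointedConvexCone C) {c d : Y}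
    (hc : c ∈ C) (hd : d ∈ C) : c + d ∈ C := by
  have h := hC.smul_mem _ (hC.convex hc hd (by norm_num : (0 : ℝ) ≤ 1 / 2)
    (by norm_num : (0 : ℝ) ≤ 1 / 2) (by norm_num)) 2 zero_le_two
  simpa [smul_smul] using h

theorem mem_of_mem_algCore (hk : k ∈ algCore C) : k ∈ C := by
  obtain ⟨δ, hδ, h⟩ := hk 0
  simpa using h 0 le_rfl hδ.le

theorem IsNontrivialPointedConvexCone.zero_mem (hC : IsNontrivialPointedConvexCone C)
    (hk : k ∈ algCore C) : (0 : Y) ∈ C := by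
  simpa using hC.smul_mem k (mem_of_mem_algCore hk) 0 le_rfl

theorem IsNontrivialPointedConvexCone.ne_zero_of_mem_algCore
    (hC : IsNontrivialPointedConvexCone C) (hk : k ∈ algCore C) : k ≠ 0 := by
  rintro rfl
  refine hC.ne_univ (eq_univ_of_forall fun v => ?_)
  obtain ⟨δ, hδ, h⟩ := hk v
  have := hC.smul_mem _ (h δ hδ.le le_rfl) δ⁻¹ (by positivity)
  simpa [smul_smul, hδ.ne'] using this

open scoped Pointwise in
theorem mem_smul_orderInterval_neg (hC : IsNontrivialPointedConvexCone C) {r : ℝ} (hr : 0 < r)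
    {y : Y} : y ∈ r • orderInterval C (-k) k ↔ r • k + y ∈ C ∧ r • k - y ∈ C := by
  have hiff : ∀ z : Y, k + r⁻¹ • z ∈ C ↔ r • k + z ∈ C := fun z => by
    constructor <;> intro h
    · simpa [smul_smul, hr.ne'] using hC.smul_mem _ h r hr.le
    · simpa [smul_smul, hr.ne'] using hC.smul_mem _ h r⁻¹ (by positivity)
  have h2 := hiff (-y)
  rw [smul_neg, ← sub_eq_add_neg, ← sub_eq_add_neg] at h2
  rw [mem_smul_set_iff_inv_smul_mem₀ hr.ne', mem_orderInterval_neg, hiff, h2]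

theorem absorbent_orderInterval_neg (hk : k ∈ algCore C) :
    Absorbent ℝ (orderInterval C (-k) k) := by
  intro y
  obtain ⟨δ₁, hδ₁, h₁⟩ := hk y
  obtain ⟨δ₂, hδ₂, h₂⟩ := hk (-y)
  have hδ : 0 < min δ₁ δ₂ := lt_min hδ₁ hδ₂
  refine (absorbs_iff_norm).2 ⟨(min δ₁ δ₂)⁻¹, fun c hc => singleton_subset_iff.2 ?_⟩
  have hc0 : 0 < |c| := (inv_pos.2 hδ).trans_le hc
  have hle : |c|⁻¹ ≤ min δ₁ δ₂ := inv_le_of_inv_le₀ hδ hc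
  have ha := h₁ |c|⁻¹ (by positivity) (hle.trans (min_le_left _ _))
  have hb := h₂ |c|⁻¹ (by positivity) (hle.trans (min_le_right _ _))
  rw [smul_neg, ← sub_eq_add_neg] at hb
  rw [mem_smul_set_iff_inv_smul_mem₀ (abs_pos.1 hc0), mem_orderInterval_neg]
  rcases abs_choice c with h | h <;> rw [h] at ha hb
  · exact ⟨ha, hb⟩
  · simp only [inv_neg, neg_smul, sub_neg_eq_add, ← sub_eq_add_neg] at ha hb
    exact ⟨hb, ha⟩

theorem convex_orderInterval_neg (hC : IsNontrivialPointedConvexCone C) :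
    Convex ℝ (orderInterval C (-k) k) := by
  intro x hx y hy a b ha hb hab
  rw [mem_orderInterval_neg] at *
  have hk : k = a • k + b • k := by rw [← add_smul, hab, one_smul]
  refine ⟨?_, ?_⟩
  · convert hC.convex hx.1 hy.1 ha hb hab using 1
    nth_rewrite 1 [hk]
    module
  · convert hC.convex hx.2 hy.2 ha hb hab using 1
    nth_rewrite 1 [hk]
    module

theorem balanced_orderInterval_neg (hC : IsNontrivialPointedConvexCone C) :
    Balanced ℝ (orderInterval C (-k) k) := by
  refine (balanced_iff_neg_mem (convex_orderInterval_neg hC)).2 fun x hx => ?_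
  rw [mem_orderInterval_neg] at hx ⊢
  simpa [sub_eq_add_neg, and_comm] using hx

theorem exists_seminorm_eq_gauge (hC : IsNontrivialPointedConvexCone C) (hk : k ∈ algCore C) :
    ∃ p : Seminorm ℝ Y, ⇑p = gauge (orderInterval C (-k) k) :=
  ⟨gaugeSeminorm (balanced_orderInterval_neg hC) (convex_orderInterval_neg hC)
    (absorbent_orderInterval_neg hk), rfl⟩

variable {p : Seminorm ℝ Y}

theorem mem_of_lt_of_eq_gauge (hC : IsNontrivialPointedConvexCone C) (hk : k ∈ algCore C)
    (hp : ⇑p = gauge (orderInterval C (-k) k)) {y : Y} {r : ℝ} (h : p y < r) :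
    r • k + y ∈ C ∧ r • k - y ∈ C := by
  have hkC := mem_of_mem_algCore hk
  rw [hp] at h
  obtain ⟨s, hs, hsr, hy⟩ := exists_lt_of_gauge_lt (absorbent_orderInterval_neg hk) h
  rw [mem_smul_orderInterval_neg hC hs] at hy
  have hrs := hC.smul_mem k hkC (r - s) (by linarith)
  constructor
  · convert hC.add_mem hrs hy.1 using 1
    module
  · convert hC.add_mem hrs hy.2 using 1
    module

theorem le_of_mem_of_eq_gauge (hC : IsNontrivialPointedConvexCone C)
    (hp : ⇑p = gauge (orderInterval C (-k) k)) {y : Y} {r : ℝ} (hr : 0 < r)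
    (h : r • k + y ∈ C ∧ r • k - y ∈ C) : p y ≤ r := by
  rw [hp]
  exact gauge_le_of_mem hr.le ((mem_smul_orderInterval_neg hC hr).2 h)

theorem IsAlgClosedSet.isNorm (hC : IsNontrivialPointedConvexCone C) (hk : k ∈ algCore C)
    (hp : ⇑p = gauge (orderInterval C (-k) k)) (hcl : IsAlgClosedSet C) : IsNorm p ∧
      orderInterval C (-k) k = {y | p y ≤ 1} := by
  have hk0 := hC.ne_zero_of_mem_algCore hk
  -- Such an `x` is linearly accessible from `x + k`.
  have hlim : ∀ x : Y, (∀ t : ℝ, 0 < t → x + t • k ∈ C) → x ∈ C := fun x hx => by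
    rw [← hcl]
    refine Or.inr ⟨x + k, by simpa using hx 1 one_pos, by simpa using hk0, fun t ht _ => ?_⟩
    convert hx t ht using 1
    module
  refine ⟨fun y hy => hC.pointed y ?_ ?_, ?_⟩
  · refine hlim y fun t ht => ?_
    rw [add_comm]
    exact (mem_of_lt_of_eq_gauge hC hk hp (hy.trans_lt ht)).1
  · refine hlim (-y) fun t ht => ?_
    rw [neg_add_eq_sub]
    exact (mem_of_lt_of_eq_gauge hC hk hp (hy.trans_lt ht)).2
  · ext y
    rw [mem_orderInterval_neg]
    refine ⟨fun h => le_of_mem_of_eq_gauge hC hp one_pos (by simpa using h), fun h => ?_⟩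
    have h' : ∀ t : ℝ, 0 < t → p y < 1 + t := fun t ht => by
      have : p y ≤ 1 := h
      linarith
    constructor
    · refine hlim _ fun t ht => ?_
      convert (mem_of_lt_of_eq_gauge hC hk hp (h' t ht)).1 using 1
      module
    · refine hlim _ fun t ht => ?_
      convert (mem_of_lt_of_eq_gauge hC hk hp (h' t ht)).2 using 1
      module

/-- The additive functional on the cone that takes the value `1` on the base. -/
theorem IsConeBase.exists_height (hC : IsNontrivialPointedConvexCone C) (h0 : (0 : Y) ∈ C)
    (hB : IsConeBase B C) : ∃ l : Y → ℝ, (∀ c ∈ C, 0 ≤ l c ∧ ∃ b ∈ B, c = l c • b) ∧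
      (∀ c ∈ C, ∀ d ∈ C, l (c + d) = l c + l d) ∧ ∀ c ∈ C, ∀ t : ℝ, 0 ≤ t → l (t • c) = t * l c := by
  classical
  -- If `0` were in `B`, halving `b` inside `B` and doubling its coefficient would give a second
  -- representation.
  have hB0 : ∀ b ∈ B, b ≠ 0 := by
    rintro _ hb rfl
    obtain ⟨c, hc, hc0⟩ : ∃ c ∈ C, c ≠ 0 := by
      by_contra! h
      exact hC.ne_zero (Subset.antisymm (fun c hc => h c hc) (singleton_subset_iff.2 h0))
    obtain ⟨⟨s, b⟩, ⟨hs, hbB, hcs⟩, -⟩ := hB.existsUnique c hc hc0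
    have hhalf : (1 / 2 : ℝ) • b ∈ B := by
      simpa using hB.convex hbB hb (by norm_num : (0 : ℝ) ≤ 1 / 2)
        (by norm_num : (0 : ℝ) ≤ 1 / 2) (by norm_num)
    have := (hB.existsUnique c hc hc0).unique (y₁ := (s, b)) (y₂ := (2 * s, (1 / 2 : ℝ) • b))
      ⟨hs, hbB, hcs⟩ ⟨by simpa using hs, hhalf, by simp only [smul_smul]; rw [hcs]; congr 1; ring⟩
    have := congrArg Prod.fst this
    simp only at this hs
    linarith
  let l : Y → ℝ := fun c => if h : ∃ z : ℝ × Y, 0 < z.1 ∧ z.2 ∈ B ∧ c = z.1 • z.2 then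
    h.choose.1 else 0
  have hl : ∀ s : ℝ, 0 ≤ s → ∀ b ∈ B, l (s • b) = s := by
    intro s hs b hb
    rcases hs.eq_or_lt with rfl | hs
    · refine dif_neg ?_
      rintro ⟨⟨t, b'⟩, ht, hb', h⟩
      rw [zero_smul, eq_comm, smul_eq_zero] at h
      exact h.elim ht.ne' (hB0 b' hb')
    · have h : ∃ z : ℝ × Y, 0 < z.1 ∧ z.2 ∈ B ∧ s • b = z.1 • z.2 := ⟨(s, b), hs, hb, rfl⟩
      have hne : s • b ≠ 0 := smul_ne_zero hs.ne' (hB0 b hb)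
      have := (hB.existsUnique _ (hC.smul_mem b (hB.subset hb) s hs.le) hne).unique
        h.choose_spec (y₂ := (s, b)) ⟨hs, hb, rfl⟩
      simp only [l, dif_pos h, this]
  have hrep : ∀ c ∈ C, ∃ s : ℝ, 0 ≤ s ∧ ∃ b ∈ B, c = s • b := by
    intro c hc
    by_cases hc0 : c = 0
    · obtain ⟨b, hb⟩ := hB.nonempty
      exact ⟨0, le_rfl, b, hb, by simp [hc0]⟩
    · obtain ⟨⟨s, b⟩, ⟨hs, hb, h⟩, -⟩ := hB.existsUnique c hc hc0
      exact ⟨s, hs.le, b, hb, h⟩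
  refine ⟨l, fun c hc => ?_, fun c hc d hd => ?_, fun c hc t ht => ?_⟩
  · obtain ⟨s, hs, b, hb, rfl⟩ := hrep c hc
    rw [hl s hs b hb]
    exact ⟨hs, b, hb, rfl⟩
  · obtain ⟨s, hs, b, hb, rfl⟩ := hrep c hc
    obtain ⟨t, ht, b', hb', rfl⟩ := hrep d hd
    obtain ⟨b'', hb'', h⟩ : ∃ b'' ∈ B, s • b + t • b' = (s + t) • b'' := by
      rcases (add_nonneg hs ht).eq_or_lt with hst | hst
      · have hs0 : s = 0 := by linarith
        have ht0 : t = 0 := by linarith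
        exact ⟨b, hb, by simp [hs0, ht0]⟩
      · refine ⟨(s / (s + t)) • b + (t / (s + t)) • b', hB.convex hb hb' (by positivity)
          (by positivity) (by field_simp), ?_⟩
        rw [smul_add, smul_smul, smul_smul, mul_div_cancel₀ _ hst.ne', mul_div_cancel₀ _ hst.ne']
    rw [h, hl _ (add_nonneg hs ht) _ hb'', hl s hs b hb, hl t ht b' hb']
  · obtain ⟨s, hs, b, hb, rfl⟩ := hrep c hc
    rw [smul_smul, hl _ (mul_nonneg ht hs) _ hb, hl s hs b hb]

end Cone

/-! ### Topology of the gauge seminorm -/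

section Topological

variable {Y : Type*} [AddCommGroup Y] [Module ℝ Y] {B C : Set Y} {k : Y} {p : Seminorm ℝ Y}

/-- For `p z = 0`, the vectors `k + z` and `δ • k - z` lie in `C` for every `δ > 0`, so additivity
gives `l (k + z) ≤ l k`. Applied to `y` and `-y`, whose translates sum to `k + k`, this forces
equality. -/
theorem height_add_of_seminorm_eq_zero (hC : IsNontrivialPointedConvexCone C)
    (hk : k ∈ algCore C) (hp : ⇑p = gauge (orderInterval C (-k) k)) {l : Y → ℝ}
    (hl : ∀ c ∈ C, 0 ≤ l c) (hladd : ∀ c ∈ C, ∀ d ∈ C, l (c + d) = l c + l d)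
    (hlsmul : ∀ c ∈ C, ∀ t : ℝ, 0 ≤ t → l (t • c) = t * l c) {y : Y} (hy : p y = 0) :
    k + y ∈ C ∧ l (k + y) = l k := by
  have hkC := mem_of_mem_algCore hk
  have key : ∀ z : Y, p z = 0 → k + z ∈ C ∧ l (k + z) ≤ l k := by
    intro z hz
    have h1 := mem_of_lt_of_eq_gauge hC hk hp (hz.trans_lt one_pos)
    rw [one_smul] at h1
    refine ⟨h1.1, le_of_forall_pos_le_add fun ε hε => ?_⟩
    have hlk := hl k hkC
    have hδ : 0 < ε / (l k + 1) := by positivity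
    have h2 := (mem_of_lt_of_eq_gauge hC hk hp (hz.trans_lt hδ)).2
    have h3 := hladd _ h1.1 _ h2
    rw [show k + z + ((ε / (l k + 1)) • k - z) = k + (ε / (l k + 1)) • k by abel,
      hladd _ hkC _ (hC.smul_mem k hkC _ hδ.le), hlsmul k hkC _ hδ.le] at h3
    have h4 := hl _ h2
    have h5 : ε / (l k + 1) * l k ≤ ε := by
      rw [div_mul_eq_mul_div, div_le_iff₀ (by positivity)]
      nlinarith
    linarith
  obtain ⟨h1, h2⟩ := key y hy
  obtain ⟨h3, h4⟩ := key (-y) (by rw [map_neg_eq_map, hy])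
  refine ⟨h1, le_antisymm h2 ?_⟩
  have h5 := hladd _ h1 _ h3
  rw [show k + y + (k + -y) = k + k by abel, hladd k hkC k hkC] at h5
  linarith

theorem height_pos (hC : IsNontrivialPointedConvexCone C) (hk : k ∈ algCore C) {l : Y → ℝ}
    (hl : ∀ c ∈ C, 0 ≤ l c ∧ ∃ b ∈ B, c = l c • b) : 0 < l k := by
  obtain ⟨h1, b, -, h2⟩ := hl k (mem_of_mem_algCore hk)
  refine h1.lt_of_ne fun h => hC.ne_zero_of_mem_algCore hk ?_
  rw [h2, ← h, zero_smul]

theorem mem_smul_base_of_mem {l : Y → ℝ} (hkC : k ∈ C)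
    (hl : ∀ c ∈ C, 0 ≤ l c ∧ ∃ b ∈ B, c = l c • b)
    (hladd : ∀ c ∈ C, ∀ d ∈ C, l (c + d) = l c + l d)
    (hlsmul : ∀ c ∈ C, ∀ t : ℝ, 0 ≤ t → l (t • c) = t * l c) {y : Y} {r : ℝ} (hr : 0 ≤ r)
    (h : r • k + y ∈ C ∧ r • k - y ∈ C) :
    y ∈ (fun z : ℝ × Y => z.1 • z.2 - r • k) '' Icc 0 (2 * r * l k) ×ˢ B := by
  obtain ⟨h1, b, hb, h2⟩ := hl _ h.1
  have h3 := hladd _ h.1 _ h.2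
  rw [show r • k + y + (r • k - y) = (2 * r) • k by module, hlsmul k hkC _ (by positivity)] at h3
  have h4 := (hl _ h.2).1
  exact ⟨(l (r • k + y), b), ⟨⟨h1, by linarith⟩, hb⟩, by simp [← h2]⟩

/-- The normed group structure of `(Y, q)` when `q` is a norm. -/
@[reducible]
noncomputable def IsNorm.normedAddCommGroup {q : Seminorm ℝ Y} (hq : IsNorm q) :
    NormedAddCommGroup (SeminormedCopy q) :=
  NormedAddCommGroup.ofSeparation fun y hy => hq y hy

theorem isReflexiveSpace_of_base_isCompact (hC : IsNontrivialPointedConvexCone C)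
    (hk : k ∈ algCore C) (hp : ⇑p = gauge (orderInterval C (-k) k)) (hn : IsNorm p)
    (hB : IsConeBase B C)
    (hBc : IsCompact (toWeakSpace ℝ (SeminormedCopy p) '' (SeminormedCopy.equiv p '' B))) :
    IsReflexiveSpace (SeminormedCopy p) ∧ CompleteSpace (SeminormedCopy p) ∧
      IsAsplundSpace (SeminormedCopy p) := by
  obtain ⟨l, hl, hladd, hlsmul⟩ := hB.exists_height hC (hC.zero_mem hk)
  have hrefl : IsReflexiveSpace (SeminormedCopy p) := by
    refine isReflexiveSpace_of_isCompact (isCompact_toWeakSpace_image_smul_sub hBc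
      -- Radius `2` leaves room for the strict inequality `p x < 2`; without algebraic closedness `p
      -- x ≤ 1` need not put `x` in the interval.
      (2 * 2 * l k) (SeminormedCopy.equiv p ((2 : ℝ) • k))) fun x hx => ?_
    have hx0 : ‖x‖ ≤ 1 := by simpa using hx
    have hx1 : p x ≤ 1 := hx0
    obtain ⟨⟨s, b⟩, ⟨hs, hb⟩, h⟩ := mem_smul_base_of_mem
      (mem_of_mem_algCore hk) hl hladd hlsmul zero_le_two
      (mem_of_lt_of_eq_gauge hC hk hp (hx1.trans_lt one_lt_two))
    exact ⟨(s, SeminormedCopy.equiv p b), ⟨hs, mem_image_of_mem _ hb⟩, h⟩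
  let i₁ := hn.normedAddCommGroup
  let i₂ : @NormedSpace ℝ (SeminormedCopy p) _ i₁.toSeminormedAddCommGroup :=
    SeminormedCopy.instNormedSpace p
  exact ⟨hrefl, @IsReflexiveSpace.completeSpace _ i₁ i₂ hrefl,
    @IsReflexiveSpace.isAsplundSpace _ i₁ i₂ hrefl⟩

/-- If `p y = 0`, then `k` and `k + y` have equal height, so their base points differ by a multiple
of `y` and are inseparable in the weak topology. Only the Hausdorff half of weak compactness is
needed to identify them. -/
theorem isNorm_of_base_isWeaklyCompact (hC : IsNontrivialPointedConvexCone C)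
    (hk : k ∈ algCore C) (hp : ⇑p = gauge (orderInterval C (-k) k)) (hB : IsConeBase B C)
    (hBc : IsWeaklyCompact (SeminormedCopy.equiv p '' B)) : IsNorm p := by
  obtain ⟨l, hl, hladd, hlsmul⟩ := hB.exists_height hC (hC.zero_mem hk)
  intro y hy
  have hlk := height_pos hC hk hl
  obtain ⟨hyC, hly⟩ := height_add_of_seminorm_eq_zero hC hk hp (fun c hc => (hl c hc).1) hladd
    hlsmul hy
  obtain ⟨-, b, hb, h1⟩ := hl k (mem_of_mem_algCore hk)
  obtain ⟨-, b', hb', h2⟩ := hl _ hyC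
  rw [hly] at h2
  have hsub : l k • (b' - b) = y := by rw [smul_sub, ← h1, ← h2]; abel
  have hpb : p (b' - b) = 0 := by
    have := congrArg p hsub
    rw [map_smul_eq_mul, hy, mul_eq_zero] at this
    exact this.resolve_left (by simpa using hlk.ne')
  have hins : Inseparable (SeminormedCopy.equiv p b') (SeminormedCopy.equiv p b) := by
    rw [Metric.inseparable_iff, dist_eq_norm, ← map_sub]
    exact hpb
  have hins' := hins.map (toWeakSpaceCLM ℝ (SeminormedCopy p)).continuous
  have := hBc.2
  have hsubtype : Inseparable
      (⟨_, mem_image_of_mem (toWeakSpace ℝ (SeminormedCopy p)) (mem_image_of_mem _ hb')⟩ :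
        toWeakSpace ℝ (SeminormedCopy p) '' (SeminormedCopy.equiv p '' B))
      ⟨_, mem_image_of_mem (toWeakSpace ℝ (SeminormedCopy p)) (mem_image_of_mem _ hb)⟩ :=
    Topology.IsInducing.subtypeVal.inseparable_iff.1 hins'
  have heq : b' = b := by simpa using hsubtype.eq
  rw [← hsub, heq, sub_self, smul_zero]

theorem lowerSemicontinuous_of_isClosed [TopologicalSpace Y]
    (hC : IsNontrivialPointedConvexCone C) (hk : k ∈ algCore C)
    (hp : ⇑p = gauge (orderInterval C (-k) k))
    (hcl : ∀ r : ℝ, 0 < r → IsClosed {y : Y | r • k + y ∈ C ∧ r • k - y ∈ C}) :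
    LowerSemicontinuous p := by
  rw [lowerSemicontinuous_iff_isClosed_preimage]
  intro r
  rcases lt_or_ge r 0 with hr0 | hr0
  · convert isClosed_empty
    exact eq_empty_of_forall_notMem fun y hy => (hr0.trans_le (apply_nonneg p y)).not_ge hy
  have : p ⁻¹' Iic r =
      ⋂ s : {s : ℝ // r < s}, {y : Y | s.1 • k + y ∈ C ∧ s.1 • k - y ∈ C} := by
    ext y
    simp only [mem_preimage, mem_Iic, mem_iInter, Subtype.forall]
    exact ⟨fun h s hs => mem_of_lt_of_eq_gauge hC hk hp (h.trans_lt hs), fun h =>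
      le_of_forall_gt_imp_ge_of_dense fun s hs =>
        le_of_mem_of_eq_gauge hC hp (hr0.trans_lt hs) (h s hs)⟩
  rw [this]
  exact isClosed_iInter fun s => hcl s.1 (hr0.trans_lt s.2)

theorem isAlgClosedSet_of_isClosed [TopologicalSpace Y] [IsTopologicalAddGroup Y]
    [ContinuousSMul ℝ Y] (h : IsClosed C) : IsAlgClosedSet C := by
  refine Subset.antisymm (union_subset Subset.rfl ?_) subset_union_left
  rintro x ⟨a, -, -, ha⟩
  have hcont : Continuous fun t : ℝ => t • a + (1 - t) • x := by fun_prop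
  have hmem : (0 : ℝ) ∈ closure (Ioc (0 : ℝ) 1) := by
    rw [closure_Ioc zero_ne_one]
    exact ⟨le_rfl, zero_le_one⟩
  have := map_mem_closure hcont hmem (t := C) fun t ht => ha t ht.1 ht.2
  rw [h.closure_eq] at this
  simpa using this

/-- A core point `x` has `x - δ • k` in `C` for some `δ > 0`; adding `δ • k + z` with `p z < δ`
keeps the whole `δ`-ball around `x` in `C`. -/
theorem image_algCore_eq_interior (hC : IsNontrivialPointedConvexCone C) (hk : k ∈ algCore C)
    (hp : ⇑p = gauge (orderInterval C (-k) k)) :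
    SeminormedCopy.equiv p '' algCore C = interior (SeminormedCopy.equiv p '' C) := by
  have hkC := mem_of_mem_algCore hk
  refine Subset.antisymm ?_ ?_
  · rintro _ ⟨x, hx, rfl⟩
    obtain ⟨δ, hδ, h⟩ := hx (-k)
    refine mem_interior_iff_mem_nhds.2 (Metric.mem_nhds_iff.2 ⟨δ, hδ, fun y hy => ?_⟩)
    rw [Metric.mem_ball, dist_eq_norm] at hy
    have hy' : p ((SeminormedCopy.equiv p).symm y - x) < δ := hy
    refine ⟨(SeminormedCopy.equiv p).symm y, ?_, by simp⟩
    convert hC.add_mem (h δ hδ.le le_rfl) (mem_of_lt_of_eq_gauge hC hk hp hy').1 using 1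
    module
  · intro y hy
    obtain ⟨x, hx, rfl⟩ := interior_subset hy
    obtain ⟨δ, hδ, h⟩ := Metric.mem_nhds_iff.1 (mem_interior_iff_mem_nhds.1 hy)
    refine ⟨x, fun v => ⟨δ / (p v + 1), by positivity, fun t ht0 ht => ?_⟩, rfl⟩
    obtain ⟨z, hz, hzx⟩ := h (show SeminormedCopy.equiv p (x + t • v) ∈ _ by
      rw [Metric.mem_ball, dist_eq_norm, ← map_sub, add_sub_cancel_left,
        SeminormedCopy.norm_equiv, map_smul_eq_mul, Real.norm_of_nonneg ht0]
      rw [le_div_iff₀ (by positivity)] at ht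
      rcases ht0.eq_or_lt with rfl | ht0
      · simpa using hδ
      · nlinarith [apply_nonneg p v])
    rwa [(SeminormedCopy.equiv p).injective hzx] at hz

theorem continuous_of_mem_interior [TopologicalSpace Y] [IsTopologicalAddGroup Y]
    [ContinuousSMul ℝ Y] (hC : IsNontrivialPointedConvexCone C)
    (hp : ⇑p = gauge (orderInterval C (-k) k)) (hk : k ∈ interior C) : Continuous p := by
  rw [hp]
  refine continuous_gauge (convex_orderInterval_neg hC) ?_
  have h1 : ∀ᶠ y in nhds (0 : Y), k + y ∈ C :=
    (by fun_prop : Continuous fun y : Y => k + y).continuousAt.eventually_mem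
      (by simpa [mem_interior_iff_mem_nhds] using hk)
  have h2 : ∀ᶠ y in nhds (0 : Y), k - y ∈ C :=
    (by fun_prop : Continuous fun y : Y => k - y).continuousAt.eventually_mem
      (by simpa [mem_interior_iff_mem_nhds] using hk)
  filter_upwards [h1, h2] with y hy1 hy2
  exact mem_orderInterval_neg.2 ⟨hy1, hy2⟩

theorem continuous_of_finiteDimensional_of_t2 [TopologicalSpace Y] [IsTopologicalAddGroup Y]
    [ContinuousSMul ℝ Y] [T2Space Y] [FiniteDimensional ℝ Y] : Continuous p := by
  have h : Continuous (SeminormedCopy.equiv p).toLinearMap :=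
    LinearMap.continuous_of_finiteDimensional _
  exact continuous_norm.comp h

/-! ### Weakly compact bases in Hausdorff locally convex spaces -/

section WeaklyCompactBase

variable [TopologicalSpace Y] [IsTopologicalAddGroup Y] [ContinuousSMul ℝ Y]
  [LocallyConvexSpace ℝ Y] [T2Space Y]

/-- The interval equals `K ∩ -K`: it is symmetric and contained in `K`, while `r • k + K` is
contained in `C`. -/
theorem isCompact_toWeakSpace_image_interval (hC : IsNontrivialPointedConvexCone C)
    (hk : k ∈ algCore C) (hB : IsConeBase B C) (hBc : IsCompact (toWeakSpace ℝ Y '' B)) {r : ℝ}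
    (hr : 0 ≤ r) : IsCompact (toWeakSpace ℝ Y '' {y | r • k + y ∈ C ∧ r • k - y ∈ C}) := by
  obtain ⟨l, hl, hladd, hlsmul⟩ := hB.exists_height hC (hC.zero_mem hk)
  have hkC := mem_of_mem_algCore hk
  have hK := isCompact_toWeakSpace_image_smul_sub hBc (2 * r * l k) (r • k)
  set K := (fun z : ℝ × Y => z.1 • z.2 - r • k) '' Icc 0 (2 * r * l k) ×ˢ B with hKdef
  have hKC : ∀ y ∈ K, r • k + y ∈ C := by
    rintro _ ⟨⟨s, b⟩, ⟨hs, hb⟩, rfl⟩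
    simpa using hC.smul_mem b (hB.subset hb) s hs.1
  have hKneg := hK.image (f := fun w => -w) continuous_neg
  have hcap := hK.inter hKneg
  convert hcap using 1
  ext w
  constructor
  · rintro ⟨y, hy, rfl⟩
    refine ⟨mem_image_of_mem _ (mem_smul_base_of_mem hkC hl hladd hlsmul hr hy), ?_⟩
    refine ⟨toWeakSpace ℝ Y (-y), mem_image_of_mem _
      (mem_smul_base_of_mem hkC hl hladd hlsmul hr ⟨?_, ?_⟩), by simp⟩
    · simpa [sub_eq_add_neg] using hy.2
    · simpa using hy.1
  · rintro ⟨⟨y, hy, rfl⟩, ⟨_, ⟨z, hz, rfl⟩, h⟩⟩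
    have hzy : -z = y := (toWeakSpace ℝ Y).injective (by simpa using h)
    subst hzy
    exact ⟨_, ⟨hKC _ hy, by simpa using hKC z hz⟩, rfl⟩

/-- A nonzero `p`-null vector would place a whole line in a weakly compact set, on which every
continuous functional is bounded. -/
theorem isNorm_of_base_isCompact (hC : IsNontrivialPointedConvexCone C) (hk : k ∈ algCore C)
    (hp : ⇑p = gauge (orderInterval C (-k) k)) (hB : IsConeBase B C)
    (hBc : IsCompact (toWeakSpace ℝ Y '' B)) : IsNorm p := by
  intro y hy
  by_contra hy0
  obtain ⟨φ, hφ⟩ := SeparatingDual.exists_eq_one (R := ℝ) hy0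
  obtain ⟨M, hM⟩ := ((isCompact_toWeakSpace_image_interval hC hk hB hBc zero_le_one).image
    (continuous_weakSpace_apply φ)).bddAbove
  have hmem : p ((M + 1) • y) < 1 := by simp [map_smul_eq_mul, hy]
  have := hM ⟨_, mem_image_of_mem _ (mem_of_lt_of_eq_gauge hC hk hp hmem), rfl⟩
  simp [hφ] at this
  linarith

/-- A `p`-Cauchy sequence has, after translation, a tail in a weakly compact interval, hence a weak
cluster point. Small intervals are weakly closed, so the Cauchy estimates pass to that point and
make it the `p`-limit. -/
theorem completeSpace_of_base_isCompact (hC : IsNontrivialPointedConvexCone C)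
    (hk : k ∈ algCore C) (hp : ⇑p = gauge (orderInterval C (-k) k)) (hB : IsConeBase B C)
    (hBc : IsCompact (toWeakSpace ℝ Y '' B)) : CompleteSpace (SeminormedCopy p) := by
  have hQ := fun (r : ℝ) (hr : 0 < r) =>
    isCompact_toWeakSpace_image_interval hC hk hB hBc hr.le
  refine Metric.complete_of_cauchySeq_tendsto fun u' hu => ?_
  obtain ⟨u, rfl⟩ : ∃ u : ℕ → Y, u' = fun n => SeminormedCopy.equiv p (u n) :=
    ⟨fun n => (SeminormedCopy.equiv p).symm (u' n), by simp⟩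
  have hu' : ∀ ε > 0, ∃ N, ∀ m ≥ N, ∀ n ≥ N, p (u m - u n) < ε := fun ε hε => by
    obtain ⟨N, hN⟩ := Metric.cauchySeq_iff.1 hu ε hε
    refine ⟨N, fun m hm n hn => ?_⟩
    have := hN m hm n hn
    rwa [dist_eq_norm, ← map_sub, SeminormedCopy.norm_equiv] at this
  obtain ⟨N, hN⟩ := hu' 1 one_pos
  let v : ℕ → WeakSpace ℝ Y := fun n => toWeakSpace ℝ Y (u n - u N)
  obtain ⟨_, ⟨a, -, rfl⟩, ha⟩ := (hQ 1 one_pos).exists_mapClusterPt (f := Filter.atTop) (u := v)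
    (Filter.le_principal_iff.2 (Filter.mem_map.2 (Filter.eventually_atTop.2
      ⟨N, fun n hn => mem_image_of_mem _ (mem_of_lt_of_eq_gauge hC hk hp (hN n hn N le_rfl))⟩)))
  refine ⟨SeminormedCopy.equiv p (a + u N), Metric.tendsto_atTop.2 fun ε hε => ?_⟩
  obtain ⟨N', hN'⟩ := hu' (ε / 2) (half_pos hε)
  refine ⟨N', fun n hn => ?_⟩
  have hcl : IsClosed ((fun w => w - v n) ⁻¹'
      (toWeakSpace ℝ Y '' {y | (ε / 2) • k + y ∈ C ∧ (ε / 2) • k - y ∈ C})) :=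
    (hQ _ (half_pos hε)).isClosed.preimage (by fun_prop)
  obtain ⟨y, hy, hya⟩ := hcl.mem_of_mapClusterPt ha (Filter.eventually_atTop.2 ⟨N', fun m hm =>
    ⟨u m - u n, mem_of_lt_of_eq_gauge hC hk hp (hN' m hm n hn), by simp [v]⟩⟩)
  have hya' : y = a - (u n - u N) :=
    (toWeakSpace ℝ Y).injective (hya.trans (map_sub (toWeakSpace ℝ Y) _ _).symm)
  rw [dist_comm, dist_eq_norm, ← map_sub, SeminormedCopy.norm_equiv,
    show a + u N - u n = y by rw [hya']; abel]
  linarith [le_of_mem_of_eq_gauge hC hp (half_pos hε) hy]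

/-- Weakly compact intervals are closed, so `p` is lower semicontinuous and, by barrelledness,
continuous. The identity into `(Y, p)` is then continuous, hence weakly continuous. -/
theorem isCompact_toWeakSpace_image_of_barrelledSpace [BarrelledSpace ℝ Y]
    (hC : IsNontrivialPointedConvexCone C) (hk : k ∈ algCore C)
    (hp : ⇑p = gauge (orderInterval C (-k) k)) (hB : IsConeBase B C)
    (hBc : IsCompact (toWeakSpace ℝ Y '' B)) :
    IsCompact (toWeakSpace ℝ (SeminormedCopy p) '' (SeminormedCopy.equiv p '' B)) := by
  have hpc : Continuous p := by
    refine p.continuous_of_lowerSemicontinuous (lowerSemicontinuous_of_isClosed hC hk hp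
      fun r hr => ?_)
    rw [← preimage_image_eq {y | r • k + y ∈ C ∧ r • k - y ∈ C} (toWeakSpace ℝ Y).injective]
    exact (isCompact_toWeakSpace_image_interval hC hk hB hBc hr.le).isClosed.preimage
      (toWeakSpaceCLM ℝ Y).continuous
  have hcont : Continuous (SeminormedCopy.equiv p) := by
    refine continuous_iff_continuousAt.2 fun x => tendsto_iff_norm_sub_tendsto_zero.2 ?_
    have hsub : Continuous fun y => p (y - x) := hpc.comp (by fun_prop)
    have h : Filter.Tendsto (fun y => p (y - x)) (nhds x) (nhds 0) := by simpa using hsub.tendsto x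
    exact h
  let e : Y →L[ℝ] SeminormedCopy p := ⟨(SeminormedCopy.equiv p).toLinearMap, hcont⟩
  have := hBc.image (WeakSpace.map e).continuous
  rw [image_image] at this ⊢
  exact this

end WeaklyCompactBase

end Topological

theorem mainTheorem9 {Y : Type*} [AddCommGroup Y] [Module ℝ Y] (C : Set Y)
    (hC : IsNontrivialPointedConvexCone C) (k : Y) (hk : k ∈ algCore C) :
    -- the order interval is absorbing, so that its Minkowski functional is finite everywhere
    Absorbent ℝ (orderInterval C (-k) k) ∧
    -- (a) the Minkowski functional is a seminorm `p`
    ∃ p : Seminorm ℝ Y, ⇑p = gauge (orderInterval C (-k) k) ∧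
    -- (b)
    (IsAlgClosedSet C → IsNorm p ∧ orderInterval C (-k) k = {y | p y ≤ 1}) ∧
    -- (c) a base that is weakly compact in the space `(Y, p)` itself
    ((∃ B : Set Y, IsConeBase B C ∧ IsWeaklyCompact (SeminormedCopy.equiv p '' B)) →
      IsNorm p ∧ IsReflexiveSpace (SeminormedCopy p) ∧ CompleteSpace (SeminormedCopy p) ∧
        IsAsplundSpace (SeminormedCopy p)) ∧
    -- (c) a base that is weakly compact for a given Hausdorff locally convex topology
    (∀ [TopologicalSpace Y] [IsTopologicalAddGroup Y] [ContinuousSMul ℝ Y]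
      [LocallyConvexSpace ℝ Y] [T2Space Y],
      (∃ B : Set Y, IsConeBase B C ∧ IsWeaklyCompact B) →
        IsNorm p ∧ CompleteSpace (SeminormedCopy p) ∧
        (BarrelledSpace ℝ Y →
          IsReflexiveSpace (SeminormedCopy p) ∧ IsAsplundSpace (SeminormedCopy p))) ∧
    -- (d)
    (∀ [TopologicalSpace Y] [IsTopologicalAddGroup Y] [ContinuousSMul ℝ Y] [T2Space Y],
      FiniteDimensional ℝ Y → Continuous p) ∧
    -- (e), (f) and the corollary
    (∀ [TopologicalSpace Y] [IsTopologicalAddGroup Y] [ContinuousSMul ℝ Y], IsClosed C →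
      (IsNorm p ∧ LowerSemicontinuous p ∧ orderInterval C (-k) k = {y | p y ≤ 1} ∧
        (interior (SeminormedCopy.equiv p '' C)).Nonempty) ∧
      (k ∈ interior C → Continuous p) ∧
      (∃ n : Seminorm ℝ Y, IsNorm n ∧
        SeminormedCopy.equiv n '' algCore C = interior (SeminormedCopy.equiv n '' C))) := by
  obtain ⟨p, hp⟩ := exists_seminorm_eq_gauge hC hk
  refine ⟨absorbent_orderInterval_neg hk, p, hp, fun h => h.isNorm hC hk hp, ?_, ?_, ?_, ?_⟩
  · rintro ⟨B, hB, hBc⟩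
    have hn := isNorm_of_base_isWeaklyCompact hC hk hp hB hBc
    exact ⟨hn, isReflexiveSpace_of_base_isCompact hC hk hp hn hB hBc.1⟩
  · rintro _ _ _ _ _ ⟨B, hB, hBc⟩
    have hn := isNorm_of_base_isCompact hC hk hp hB hBc.1
    refine ⟨hn, completeSpace_of_base_isCompact hC hk hp hB hBc.1, fun _ => ?_⟩
    obtain ⟨h1, -, h2⟩ := isReflexiveSpace_of_base_isCompact hC hk hp hn hB
      (isCompact_toWeakSpace_image_of_barrelledSpace hC hk hp hB hBc.1)
    exact ⟨h1, h2⟩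
  · intro _ _ _ _ _
    exact continuous_of_finiteDimensional_of_t2
  · intro _ _ _ hcl
    obtain ⟨hn, hunit⟩ := (isAlgClosedSet_of_isClosed hcl).isNorm hC hk hp
    have hcore := image_algCore_eq_interior hC hk hp
    refine ⟨⟨hn, lowerSemicontinuous_of_isClosed hC hk hp fun r _ => ?_, hunit, ?_⟩,
      continuous_of_mem_interior hC hp, p, hn, hcore⟩
    · exact (hcl.preimage (by fun_prop : Continuous fun y : Y => r • k + y)).inter
        (hcl.preimage (by fun_prop : Continuous fun y : Y => r • k - y))
    · rw [← hcore]
      exact ⟨_, mem_image_of_mem _ hk⟩
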